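/- Let $n\ge 3$, let $X=\{x\in\mathbb R^n:\|x\|_\infty=1\}$ be the unit sphere of $\mathbb R^n$ with the sup norm, and let $d(A,B)$ be the geodesic distance on $X$ induced by the sup norm, i.e. the infimum of the $\|\cdot\|_\infty$-lengths of the continuous curves in $X$ from $A$ to $B$. Let $A=(1,a_2,\dots,a_n)\in X$ and $B=(-1,b_2,\dots,b_n)\in X$. Then $d(A,B)$ is finite and equals the minimum of the numbers $$\max\Big(\{\,2+\varepsilon_{m+1}a_{c_{m+1}}+\varepsilon_m b_{c_m}: 1\le m<p\,\}\cup\{\,4+\varepsilon_1a_{c_1}+\varepsilon_p b_{c_p}\,\}\Big),$$ where $1\le p\le n-1$, where $(c_1,\dots,c_p)$ is a sequence of distinct elements of $\{2,\dots,n\}$, and where $\varepsilon_1,\dots,\varepsilon_p\in\{1,-1\}$ (for $p=1$ the number is $4+\varepsilon_1(a_{c_1}+b_{c_1})$). The number of these terms, i.e. of triples $(p,(c_m),(\varepsilon_m))$, is $\lfloor (n-1)!\,2^{n-1}\sqrt e\rfloor-1$. -/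

import Mathlib

/-- The geodesic (induced length) distance of a metric space, with values in `[0, ∞]`: the infimum
of the lengths of all continuous curves in the space from `x` to `y`. The length of a curve is its
total variation with respect to the metric of the space. -/
noncomputable def geodEDist {X : Type*} [PseudoEMetricSpace X] (x y : X) : ENNReal :=
  ⨅ γ : Path x y, eVariationOn γ Set.univ

/-- The unit sphere of `ℝⁿ` with the sup norm (the norm of `Fin n → ℝ`), with the metric
induced by this norm. -/
abbrev SupSphere (n : ℕ) : Type := Metric.sphere (0 : Fin n → ℝ) 1

/-- The indices of the terms: a length `p + 1` with `1 ≤ p + 1 ≤ n - 1`, a sequence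
`c 0, …, c p` of distinct coordinates other than the first coordinate (which has index `0` in
`Fin n`), and a sign `ε m ∈ {1, -1}` for each of the chosen coordinates `c m`. -/
structure ChainTerm (n : ℕ) where
  p : Fin (n - 1)
  c : Fin (p + 1) ↪ {i : Fin n // (i : ℕ) ≠ 0}
  ε : Fin (p + 1) → ℤˣ

namespace ChainTerm

/-- The entry of index `m` of the chained maximum. Addition in `Fin (p + 1)` is cyclic, so these
are the numbers `2 + ε (m+1) * a (c (m+1)) + ε m * b (c m)` for `m < p`, and the number
`4 + ε 0 * a (c 0) + ε p * b (c p)` for `m = p`. -/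
noncomputable def entry {n : ℕ} (t : ChainTerm n) (a b : Fin n → ℝ) (m : Fin (t.p + 1)) : ℝ :=
  (if m = Fin.last t.p then 4 else 2)
    + ((t.ε (m + 1) : ℤ) : ℝ) * a (t.c (m + 1)) + ((t.ε m : ℤ) : ℝ) * b (t.c m)

/-- The chained maximum
`max {2 ± a_{c 1} ± b_{c 0}, 2 ± a_{c 2} ± b_{c 1}, …, 4 ± a_{c 0} ± b_{c p}}`;
for `p = 0` it is `4 ± a_{c 0} ± b_{c 0}` with the same sign twice. -/
noncomputable def value {n : ℕ} (t : ChainTerm n) (a b : Fin n → ℝ) : ℝ :=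
  Finset.univ.sup' Finset.univ_nonempty (t.entry a b)

end ChainTerm

/-!
Write `u m = 1 + ε m * a (c m)` and `v m = 1 + ε m * b (c m)`. These are the sup distances from `A`
and from `B` to the face `x (c m) = -ε m`, and the entries of a term are `u (m + 1) + v m` and
`u 0 + 2 + v p`.

*Every term bounds the distance from above* (`geodEDist_le_value`). Let `L` be the value of the
term. All coordinates can be moved independently with speed `1`, and the coordinate `c m` can be
at `-ε m` during the whole interval `[u m, L - v m]`. Since `u (m + 1) ≤ L - v m`, these intervals
leave no gap between `u 0` and `L - v p`, so the curve stays on the sphere there; the gap between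
these two times is at least `2`, which is what the first coordinate needs to go from `1` to `-1`.
Some of the intervals may be empty, which does no harm.

*Every curve of finite length `ℓ` bounds some term from above* (`exists_value_le_eVariationOn`).
The faces of the cube pull back to finitely many closed sets that cover the parameter interval.
As it is connected, a chain of faces leads from `x 0 = 1` to `x 0 = -1` in which consecutive
faces are met simultaneously (`reflTransGen_of_closed_cover`). Being met simultaneously is a
symmetric relation, and if `F` and `G` are met at the same time, then the distance from `A` to `G`
plus the distance from `F` to `B` is at most `ℓ`. Take a shortest chain that joins any pair of
opposite faces with no face of the coordinate `0` in between: its inner faces have distinct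
coordinates (`exists_isOppositeChain_injOn`). The curve needs the length `2` between the two ends of
the chain, so the chain of inner faces, or its reverse if the far end is met first, gives the last
entry as well (`exists_value_le_of_chain`).

*The number of terms* is the sum of `N! / (N - k)! * 2 ^ k` over `1 ≤ k ≤ N = n - 1`, which up to
the missing summand for `k = 0` is `N! * 2 ^ N` times a partial sum of the exponential series of
`1 / 2` (`floor_factorial_mul_two_pow_mul_sqrt_exp`).
-/

/-! ### The upper bound: a curve for every term -/

/-- If consecutive intervals `[α m, β m]` leave no gap, then together they cover the segment from
the first left end to the last right end. Single intervals are allowed to be empty. -/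
theorem exists_mem_Icc_of_chain {p : ℕ} {α β : Fin (p + 1) → ℝ}
    (h : ∀ i : Fin p, α i.succ ≤ β i.castSucc) {τ : ℝ} (h0 : α 0 ≤ τ) (h1 : τ ≤ β (Fin.last p)) :
    ∃ m, τ ∈ Set.Icc (α m) (β m) := by
  by_contra! hc
  have key : ∀ m, α m ≤ τ := by
    intro m
    induction m using Fin.induction with
    | zero => exact h0
    | succ i ih =>
      have : β i.castSucc < τ := by
        by_contra! hle
        exact hc i.castSucc ⟨ih, hle⟩
      linarith [h i]
  exact hc (Fin.last p) ⟨key _, h1⟩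

/-- The fastest excursion towards the value `s = ±1` of a coordinate that moves with speed at most
`1` in `[-1, 1]`, has the value `a` at time `0` and the value `b` at time `L`. -/
noncomputable def excursion (s a b L τ : ℝ) : ℝ :=
  s * min 1 (min (s * a + |τ|) (s * b + |L - τ|))

theorem lipschitzWith_excursion {s : ℝ} (hs : s = 1 ∨ s = -1) (a b L : ℝ) :
    LipschitzWith 1 (excursion s a b L) := by
  have h1 : LipschitzWith 1 fun τ : ℝ => s * a + |τ| := by
    refine LipschitzWith.of_dist_le_mul fun x y => ?_
    simpa [Real.dist_eq] using abs_abs_sub_abs_le_abs_sub x y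
  have h2 : LipschitzWith 1 fun τ : ℝ => s * b + |L - τ| := by
    refine LipschitzWith.of_dist_le_mul fun x y => ?_
    have := abs_abs_sub_abs_le_abs_sub (L - x) (L - y)
    rw [show L - x - (L - y) = -(x - y) by ring, abs_neg] at this
    simpa [Real.dist_eq] using this
  have h3 := (h1.min h2).const_min 1
  rw [max_self] at h3
  refine LipschitzWith.of_dist_le_mul fun x y => ?_
  have h4 := h3.dist_le_mul x y
  have hs' : |s| = 1 := by rcases hs with rfl | rfl <;> simp
  rw [Real.dist_eq] at h4 ⊢
  simpa only [excursion, ← mul_sub, abs_mul, hs', one_mul] using h4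

theorem abs_excursion_le_one {s a b : ℝ} (hs : s = 1 ∨ s = -1) (ha : |a| ≤ 1) (hb : |b| ≤ 1)
    (L τ : ℝ) : |excursion s a b L τ| ≤ 1 := by
  have hs' : |s| = 1 := by rcases hs with rfl | rfl <;> simp
  have h1 : -1 ≤ s * a := (abs_le.1 (by rw [abs_mul, hs', one_mul]; exact ha)).1
  have h2 : -1 ≤ s * b := (abs_le.1 (by rw [abs_mul, hs', one_mul]; exact hb)).1
  rw [excursion, abs_mul, hs', one_mul, abs_le]
  exact ⟨le_min (by norm_num) (le_min (by linarith [abs_nonneg τ])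
    (by linarith [abs_nonneg (L - τ)])), min_le_left _ _⟩

theorem excursion_zero {s a b L : ℝ} (hs : s = 1 ∨ s = -1) (ha : |a| ≤ 1) (hb : |b| ≤ 1)
    (hL : 2 ≤ L) : excursion s a b L 0 = a := by
  rw [abs_le] at ha hb
  have : |L| = L := abs_of_nonneg (by linarith)
  rcases hs with rfl | rfl <;>
  · rw [excursion, abs_zero, sub_zero, this, add_zero, min_eq_left (b := _ + L) (by linarith),
      min_eq_right (by linarith)]
    ring

theorem excursion_end {s a b L : ℝ} (hs : s = 1 ∨ s = -1) (ha : |a| ≤ 1) (hb : |b| ≤ 1)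
    (hL : 2 ≤ L) : excursion s a b L L = b := by
  rw [abs_le] at ha hb
  have : |L| = L := abs_of_nonneg (by linarith)
  rcases hs with rfl | rfl <;>
  · rw [excursion, sub_self, abs_zero, this, add_zero, min_eq_right (b := _ * b) (by linarith),
      min_eq_right (by linarith)]
    ring

theorem excursion_eq {s a b L τ : ℝ} (h1 : 1 - s * a ≤ τ) (h2 : τ ≤ L - (1 - s * b)) :
    excursion s a b L τ = s := by
  rw [excursion, min_eq_left, mul_one]
  exact le_min (by linarith [le_abs_self τ]) (by linarith [le_abs_self (L - τ)])

/-- A `1`-Lipschitz curve that stays on the sphere for `0 ≤ τ ≤ L` bounds the geodesic distance of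
its end points by `L`. -/
theorem geodEDist_le_of_lipschitz {n : ℕ} {A B : SupSphere n} {L : ℝ} (hL : 0 ≤ L)
    {Γ : ℝ → Fin n → ℝ} (hΓ : LipschitzWith 1 Γ) (h0 : Γ 0 = A) (h1 : Γ L = B)
    (hS : ∀ τ ∈ Set.Icc 0 L, ‖Γ τ‖ = 1) : geodEDist A B ≤ ENNReal.ofReal L := by
  have hcont := hΓ.continuous
  let γ : Path A B :=
    { toFun := fun x => ⟨Γ (L * x), by
        rw [mem_sphere_zero_iff_norm]
        exact hS _ ⟨mul_nonneg hL x.2.1, mul_le_of_le_one_right hL x.2.2⟩⟩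
      continuous_toFun := by fun_prop
      source' := by ext1; simp [h0]
      target' := by ext1; simp [h1] }
  refine (iInf_le _ γ).trans ?_
  have hcomp : eVariationOn γ Set.univ
      = eVariationOn (Γ ∘ fun x : unitInterval => L * x) Set.univ := rfl
  rw [hcomp]
  refine ((hΓ.lipschitzOnWith (s := Set.univ)).comp_eVariationOn_le (Set.mapsTo_univ _ _)).trans ?_
  have hmono : MonotoneOn (fun x : unitInterval => L * (x : ℝ)) Set.univ := fun x _ y _ hxy =>
    mul_le_mul_of_nonneg_left hxy hL
  have := hmono.eVariationOn_eq (Set.mem_univ 0) (Set.mem_univ 1)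
  rw [Set.univ_inter, ← Set.univ_inter (Set.Icc (0 : unitInterval) 1)] at this
  have hI : Set.Icc (0 : unitInterval) 1 = Set.univ :=
    Set.eq_univ_of_forall fun x => ⟨x.2.1, x.2.2⟩
  simpa [hI] using this.le

namespace ChainTerm

theorem entry_le_value {n : ℕ} (t : ChainTerm n) (a b : Fin n → ℝ) (m : Fin (t.p + 1)) :
    t.entry a b m ≤ t.value a b :=
  Finset.le_sup' (t.entry a b) (Finset.mem_univ m)

theorem entry_last {n : ℕ} (t : ChainTerm n) (a b : Fin n → ℝ) :
    t.entry a b (Fin.last t.p) = 4 + ((t.ε 0 : ℤ) : ℝ) * a (t.c 0)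
      + ((t.ε (Fin.last t.p) : ℤ) : ℝ) * b (t.c (Fin.last t.p)) := by
  simp [entry]

theorem entry_castSucc {n : ℕ} (t : ChainTerm n) (a b : Fin n → ℝ) (i : Fin t.p) :
    t.entry a b i.castSucc = 2 + ((t.ε i.succ : ℤ) : ℝ) * a (t.c i.succ)
      + ((t.ε i.castSucc : ℤ) : ℝ) * b (t.c i.castSucc) := by
  rw [entry, if_neg (Fin.castSucc_lt_last i).ne, Fin.coeSucc_eq_succ]

theorem coe_ε {n : ℕ} (t : ChainTerm n) (m : Fin (t.p + 1)) :
    ((t.ε m : ℤ) : ℝ) = 1 ∨ ((t.ε m : ℤ) : ℝ) = -1 := by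
  rcases Int.units_eq_one_or (t.ε m) with h | h <;> simp [h]

end ChainTerm

theorem abs_apply_le_one_of_mem_sphere {n : ℕ} {x : Fin n → ℝ}
    (hx : x ∈ Metric.sphere (0 : Fin n → ℝ) 1) (i : Fin n) : |x i| ≤ 1 := by
  have h := norm_le_pi_norm x i
  rwa [mem_sphere_zero_iff_norm.1 hx] at h

theorem ChainTerm.value_nonneg {n : ℕ} (t : ChainTerm n) (A B : SupSphere n) :
    0 ≤ t.value A B := by
  have h : ∀ (m : Fin (t.p + 1)) (y : ℝ), |y| ≤ 1 → -1 ≤ ((t.ε m : ℤ) : ℝ) * y := by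
    intro m y hy
    rw [abs_le] at hy
    rcases t.coe_ε m with h | h <;> rw [h] <;> linarith
  have h1 := t.entry_le_value A B (Fin.last t.p)
  rw [t.entry_last] at h1
  linarith [h 0 _ (abs_apply_le_one_of_mem_sphere A.2 (t.c 0)),
    h (Fin.last t.p) _ (abs_apply_le_one_of_mem_sphere B.2 (t.c (Fin.last t.p)))]

/-- The curve behind a term: each chosen coordinate `c m` makes the fastest excursion to
`-ε m`, and the first coordinate falls from `1` to `-1` with speed `1` as soon as the face of
`c 0` is reached. The inner entries of the term say that one face is reached before the previous
one is left, the last entry that the first coordinate has the time `2` it needs. -/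
theorem geodEDist_le_value {n : ℕ} (hn : 0 < n) {A B : SupSphere n}
    (hA : (A : Fin n → ℝ) ⟨0, hn⟩ = 1) (hB : (B : Fin n → ℝ) ⟨0, hn⟩ = -1) (t : ChainTerm n) :
    geodEDist A B ≤ ENNReal.ofReal (t.value A B) := by
  set L := t.value A B
  set a : Fin n → ℝ := A.1
  set b : Fin n → ℝ := B.1
  have haA : ∀ i, |a i| ≤ 1 := abs_apply_le_one_of_mem_sphere A.2
  have hbB : ∀ i, |b i| ≤ 1 := abs_apply_le_one_of_mem_sphere B.2
  have hinj : Function.Injective fun m => (t.c m : Fin n) := fun x y h =>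
    t.c.injective (Subtype.ext h)
  -- the sign of the face that a coordinate aims at; arbitrary for the coordinates not chosen
  let σ : Fin n → ℝ := Function.extend (fun m => (t.c m : Fin n))
    (fun m => -((t.ε m : ℤ) : ℝ)) (fun _ => 1)
  have hσc : ∀ m, σ (t.c m) = -((t.ε m : ℤ) : ℝ) := fun m => hinj.extend_apply _ _ m
  have hσ : ∀ i, σ i = 1 ∨ σ i = -1 := by
    intro i
    by_cases hi : ∃ m, (t.c m : Fin n) = i
    · obtain ⟨m, rfl⟩ := hi
      rw [hσc]
      rcases t.coe_ε m with h | h <;> simp [h]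
    · exact Or.inl (Function.extend_apply' _ _ _ hi)
  let α : Fin (t.p + 1) → ℝ := fun m => 1 - σ (t.c m) * a (t.c m)
  let β : Fin (t.p + 1) → ℝ := fun m => L - (1 - σ (t.c m) * b (t.c m))
  have hσabs : ∀ (i : Fin n) (x : ℝ), |x| ≤ 1 → 0 ≤ 1 - σ i * x := by
    intro i x hx
    rw [abs_le] at hx
    rcases hσ i with h | h <;> rw [h] <;> linarith
  have hα : ∀ m, 0 ≤ α m := fun m => hσabs _ _ (haA _)
  have hβ : ∀ m, β m ≤ L := fun m => by
    have := hσabs (t.c m) _ (hbB (t.c m))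
    simp only [β]
    linarith
  have hchain : ∀ i : Fin t.p, α i.succ ≤ β i.castSucc := by
    intro i
    have := t.entry_le_value a b i.castSucc
    rw [t.entry_castSucc] at this
    simp only [α, β, hσc]
    linarith
  have hgap : α 0 + 2 ≤ β (Fin.last t.p) := by
    have := t.entry_le_value a b (Fin.last t.p)
    rw [t.entry_last] at this
    simp only [α, β, hσc]
    linarith
  have hL : 2 ≤ L := by linarith [hα 0, hβ (Fin.last t.p)]
  let Γ : ℝ → Fin n → ℝ := fun τ i =>
    if (i : ℕ) = 0 then max (-1) (min 1 (1 + α 0 - τ)) else excursion (σ i) (a i) (b i) L τ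
  have hzero : ∀ i : Fin n, (i : ℕ) = 0 → i = ⟨0, hn⟩ := fun i hi => Fin.ext hi
  have hΓc : ∀ τ m, Γ τ (t.c m) = excursion (σ (t.c m)) (a (t.c m)) (b (t.c m)) L τ :=
    fun τ m => if_neg (t.c m).2
  have hΓ0 : ∀ τ, Γ τ ⟨0, hn⟩ = max (-1) (min 1 (1 + α 0 - τ)) := fun τ => if_pos rfl
  refine geodEDist_le_of_lipschitz (Γ := Γ) (by linarith) ?_ ?_ ?_ ?_
  · refine LipschitzWith.of_dist_le_mul fun x y => ?_
    rw [dist_pi_le_iff (by positivity)]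
    intro i
    by_cases hi : (i : ℕ) = 0
    · have h1 : LipschitzWith 1 fun τ : ℝ => 1 + α 0 - τ :=
        LipschitzWith.of_dist_le_mul fun x y => by
          rw [Real.dist_eq, Real.dist_eq, ← abs_neg, NNReal.coe_one, one_mul]
          exact le_of_eq (congrArg _ (by ring))
      simpa only [Γ, hi, if_true] using ((h1.const_min 1).const_max (-1)).dist_le_mul x y
    · simpa only [Γ, hi, if_false] using
        (lipschitzWith_excursion (hσ i) (a i) (b i) L).dist_le_mul x y
  · funext i
    by_cases hi : (i : ℕ) = 0
    · rw [hzero i hi, hΓ0, min_eq_left (by linarith [hα 0]), max_eq_right (by norm_num)]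
      exact hA.symm
    · simp only [Γ, hi, if_false]
      exact excursion_zero (hσ i) (haA i) (hbB i) hL
  · funext i
    by_cases hi : (i : ℕ) = 0
    · rw [hzero i hi, hΓ0,
        max_eq_left ((min_le_right _ _).trans (by linarith [hβ (Fin.last t.p)]))]
      exact hB.symm
    · simp only [Γ, hi, if_false]
      exact excursion_end (hσ i) (haA i) (hbB i) hL
  · intro τ hτ
    refine le_antisymm ((pi_norm_le_iff_of_nonneg zero_le_one).2 fun i => ?_) ?_
    · rw [Real.norm_eq_abs]
      by_cases hi : (i : ℕ) = 0
      · rw [hzero i hi, hΓ0, abs_le]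
        exact ⟨le_max_left _ _, max_le (by norm_num) (min_le_left _ _)⟩
      · simp only [Γ, hi, if_false]
        exact abs_excursion_le_one (hσ i) (haA i) (hbB i) L τ
    · -- before `α 0` and after `β (last)` the first coordinate is `±1`
      rcases le_total τ (α 0) with h0 | h0
      · have h := norm_le_pi_norm (Γ τ) ⟨0, hn⟩
        rwa [hΓ0, min_eq_left (by linarith), max_eq_right (by norm_num), norm_one] at h
      rcases le_total (β (Fin.last t.p)) τ with h1 | h1
      · have h := norm_le_pi_norm (Γ τ) ⟨0, hn⟩
        rwa [hΓ0, max_eq_left ((min_le_right _ _).trans (by linarith)), norm_neg, norm_one] at h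
      · obtain ⟨m, hm⟩ := exists_mem_Icc_of_chain hchain h0 h1
        have h := norm_le_pi_norm (Γ τ) (t.c m)
        rw [hΓc, excursion_eq hm.1 hm.2] at h
        rcases hσ (t.c m) with hs | hs <;> simpa [hs] using h

/-! ### Chains of faces -/

/-- The face `{x | x i = s}` of the cube `[-1, 1] ^ n` is encoded as the pair `(i, s)`; this is the
opposite face `{x | x i = -s}`. -/
def oppFace {ι : Type*} (F : ι × ℤˣ) : ι × ℤˣ := (F.1, -F.2)

/-- `f 0, …, f (p + 1)` is a sequence of faces, consecutive ones related by `R`, from a face to the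
opposite face, such that no inner face belongs to the coordinate `i₀`. -/
def IsOppositeChain {ι : Type*} (R : ι × ℤˣ → ι × ℤˣ → Prop) (i₀ : ι) (p : ℕ)
    (f : ℕ → ι × ℤˣ) : Prop :=
  (∀ i ≤ p, R (f i) (f (i + 1))) ∧ f (p + 1) = oppFace (f 0) ∧
    ∀ i, 1 ≤ i → i ≤ p → (f i).1 ≠ i₀

theorem eq_or_eq_oppFace {ι : Type*} {F G : ι × ℤˣ} (h : F.1 = G.1) :
    F = G ∨ G = oppFace F := by
  obtain ⟨i, s⟩ := F
  obtain ⟨j, s'⟩ := G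
  obtain rfl : i = j := h
  rcases Int.units_eq_one_or s with rfl | rfl <;> rcases Int.units_eq_one_or s' with rfl | rfl <;>
    simp [oppFace]

theorem exists_seq_of_reflTransGen {X : Type*} {R : X → X → Prop} {x y : X}
    (h : Relation.ReflTransGen R x y) :
    ∃ (p : ℕ) (f : ℕ → X), f 0 = x ∧ f p = y ∧ ∀ i < p, R (f i) (f (i + 1)) := by
  induction h using Relation.ReflTransGen.head_induction_on with
  | refl => exact ⟨0, fun _ => y, rfl, rfl, by simp⟩
  | @head u v huv _ ih =>
    obtain ⟨p, f, h0, hp, hf⟩ := ih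
    refine ⟨p + 1, fun i => Nat.casesOn i u f, rfl, hp, fun i hi => ?_⟩
    cases i with
    | zero => simpa [h0] using huv
    | succ k => exact hf k (by omega)

/-- A shortest chain from a face of the coordinate `i₀` to the opposite face visits no face of this
coordinate in between. -/
theorem exists_isOppositeChain {ι : Type*} {R : ι × ℤˣ → ι × ℤˣ → Prop} {i₀ : ι}
    (h : Relation.ReflTransGen R (i₀, 1) (i₀, -1)) : ∃ p f, IsOppositeChain R i₀ p f := by
  classical
  have hex := exists_seq_of_reflTransGen h
  obtain ⟨f, h0, hq, hf⟩ := Nat.find_spec hex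
  have hmin := fun {m : ℕ} => Nat.find_min hex (m := m)
  set q := Nat.find hex
  obtain ⟨p, hp⟩ : ∃ p, q = p + 1 := by
    refine Nat.exists_eq_succ_of_ne_zero fun hq0 => ?_
    rw [hq0, h0] at hq
    simp [Prod.ext_iff] at hq
  rw [hp] at hmin hf hq
  refine ⟨p, f, fun i hi => hf i (by omega), by rw [h0, hq]; rfl, fun i hi hip hfi => ?_⟩
  rcases eq_or_eq_oppFace (F := (i₀, 1)) (G := f i) hfi.symm with hi' | hi'
  · refine hmin (m := p + 1 - i) (by omega) ⟨fun k => f (k + i), by simp [hi'], ?_, fun k hk => ?_⟩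
    · beta_reduce
      rw [Nat.sub_add_cancel (by omega), hq]
    · have := hf (k + i) (by omega)
      rwa [show k + i + 1 = k + 1 + i by omega] at this
  · exact hmin (m := i) (by omega) ⟨f, h0, hi', fun k hk => hf k (by omega)⟩

/-- In a shortest chain the inner faces belong to distinct coordinates: between two equal faces the
chain could be cut, and two opposite inner faces delimit a shorter chain. -/
theorem exists_isOppositeChain_injOn {ι : Type*} {R : ι × ℤˣ → ι × ℤˣ → Prop} {i₀ : ι}
    (h : Relation.ReflTransGen R (i₀, 1) (i₀, -1)) :
    ∃ p f, IsOppositeChain R i₀ p f ∧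
      ∀ i j, 1 ≤ i → i < j → j ≤ p → (f i).1 ≠ (f j).1 := by
  classical
  have hex := exists_isOppositeChain h
  obtain ⟨f, hf, hopp, hside⟩ := Nat.find_spec hex
  have hmin := fun {m : ℕ} => Nat.find_min hex (m := m)
  set p := Nat.find hex
  refine ⟨p, f, ⟨hf, hopp, hside⟩, fun i j hi hij hj hfij => ?_⟩
  rcases eq_or_eq_oppFace hfij with he | he
  · refine hmin (m := p - (j - i)) (by omega)
      ⟨fun k => if k ≤ i then f k else f (k + (j - i)), fun k hk => ?_, ?_, fun k hk hkp => ?_⟩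
    · rcases lt_trichotomy k i with hki | rfl | hki
      · simpa [hki.le, Nat.succ_le_of_lt hki] using hf k (by omega)
      · have := hf j (by omega)
        rw [← he] at this
        simpa [show k + 1 + (j - k) = j + 1 by omega] using this
      · have := hf (k + (j - i)) (by omega)
        simpa [hki.not_ge, show ¬ k + 1 ≤ i by omega, add_right_comm] using this
    · beta_reduce
      rw [if_neg (by omega), if_pos (by omega), ← hopp,
        show p - (j - i) + 1 + (j - i) = p + 1 by omega]
    · by_cases hki : k ≤ i
      · simpa only [hki, if_true] using hside k hk (by omega)
      · simpa only [hki, if_false] using hside (k + (j - i)) (by omega) (by omega)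
  · refine hmin (m := j - i - 1) (by omega)
      ⟨fun k => f (k + i), fun k hk => ?_, ?_, fun k hk hkp => hside (k + i) (by omega) (by omega)⟩
    · have := hf (k + i) (by omega)
      rwa [show k + i + 1 = k + 1 + i by omega] at this
    · beta_reduce
      rw [show j - i - 1 + 1 + i = j by omega, he, zero_add]

/-- If finitely many closed sets cover a connected space, then any two nonempty ones are joined by
a chain of sets of which consecutive ones intersect. -/
theorem reflTransGen_of_closed_cover {ι X : Type*} [Finite ι] [TopologicalSpace X]
    [PreconnectedSpace X] {C : ι → Set X} (hC : ∀ i, IsClosed (C i)) (hcov : ∀ x, ∃ i, x ∈ C i)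
    {i j : ι} (hi : (C i).Nonempty) (hj : (C j).Nonempty) :
    Relation.ReflTransGen (fun k l => (C k ∩ C l).Nonempty) i j := by
  set r := Relation.ReflTransGen (fun k l => (C k ∩ C l).Nonempty) i with hr
  have hclopen : IsClopen (⋃ k ∈ {k | r k}, C k) := by
    refine ⟨Set.Finite.isClosed_biUnion (Set.toFinite _) fun k _ => hC k, ?_⟩
    rw [← isClosed_compl_iff]
    have : (⋃ k ∈ {k | r k}, C k)ᶜ = ⋃ k ∈ {k | ¬ r k}, C k := by
      ext x
      simp only [Set.mem_compl_iff, Set.mem_iUnion, Set.mem_ofPred_eq, exists_prop, not_exists,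
        not_and]
      constructor
      · intro hx
        obtain ⟨k, hk⟩ := hcov x
        exact ⟨k, fun hrk => hx k hrk hk, hk⟩
      · rintro ⟨k, hrk, hk⟩ l hl hxl
        exact hrk (hl.tail ⟨x, hxl, hk⟩)
    rw [this]
    exact Set.Finite.isClosed_biUnion (Set.toFinite _) fun k _ => hC k
  obtain ⟨x, hx⟩ := hi
  obtain ⟨y, hy⟩ := hj
  have huniv := hclopen.eq_univ ⟨x, Set.mem_biUnion (show r i from .refl) hx⟩
  have hy' : y ∈ ⋃ k ∈ {k | r k}, C k := huniv ▸ Set.mem_univ y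
  obtain ⟨k, hk, hyk⟩ := Set.mem_iUnion₂.1 hy'
  exact Relation.ReflTransGen.tail hk ⟨y, hyk, hy⟩

/-! ### The lower bound: a term for every curve -/

/-- A sequence of faces `g 0, …, g p` with distinct coordinates, of which consecutive ones are met
simultaneously by the curve `x`, gives a term bounded by the length `ℓ` if the curve is on `g 0` at a
time `s` and on `g p` at a time `t ≥ s` and some coordinate changes by `2` in between. Of the length
only the bound on the variation over `0 ≤ s ≤ t ≤ 1` is used. -/
theorem exists_value_le_of_chain {n : ℕ} {T : Type*} [LinearOrder T] {a b : Fin n → ℝ}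
    {x : T → Fin n → ℝ} {ℓ : ℝ}
    (hℓ : ∀ s t, s ≤ t → ∀ i j k, |a i - x s i| + |x s j - x t j| + |x t k - b k| ≤ ℓ)
    {p : ℕ} {g : ℕ → Fin n × ℤˣ} (hside : ∀ i ≤ p, ((g i).1 : ℕ) ≠ 0)
    (hinj : ∀ i j, i < j → j ≤ p → (g i).1 ≠ (g j).1)
    (hg : ∀ i < p, ∃ t, x t (g i).1 = ((g i).2 : ℤ) ∧ x t (g (i + 1)).1 = ((g (i + 1)).2 : ℤ))
    {s t : T} (hst : s ≤ t) (hs : x s (g 0).1 = ((g 0).2 : ℤ)) (ht : x t (g p).1 = ((g p).2 : ℤ))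
    {k : Fin n} (hk : |x s k - x t k| = 2) :
    ∃ τ : ChainTerm n, τ.value a b ≤ ℓ := by
  have hinj' : Function.Injective fun m : Fin (p + 1) => (g m).1 := by
    intro i j hij
    rcases lt_trichotomy i j with h | h | h
    · exact absurd hij (hinj i j h (by omega))
    · exact h
    · exact absurd hij.symm (hinj j i h (by omega))
  have hp : p < n - 1 := by
    have h0 : 0 < n := (g 0).1.pos
    -- together with the coordinate `0` there are `p + 2` distinct coordinates
    have : Function.Injective (Fin.cons (⟨0, h0⟩ : Fin n) fun m : Fin (p + 1) => (g m).1) :=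
      Fin.cons_injective_iff.2 ⟨by
        rintro ⟨m, hm⟩
        exact hside m (by omega) (by simpa using congrArg Fin.val hm), hinj'⟩
    have := Fintype.card_le_of_injective _ this
    simp at this
    omega
  refine ⟨⟨⟨p, hp⟩, ⟨fun m => ⟨(g m).1, hside m (by have := m.2; simp at this; omega)⟩,
    fun i j hij => hinj' (congrArg Subtype.val hij)⟩, fun m => -(g m).2⟩, ?_⟩
  refine Finset.sup'_le _ _ fun m _ => ?_
  have habs : ∀ (e : ℤˣ) (y : ℝ), 1 - (e : ℤ) * y ≤ |y - (e : ℤ)| := by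
    intro e y
    rcases Int.units_eq_one_or e with rfl | rfl
    · have := neg_le_abs (y - 1)
      simp; linarith
    · have := le_abs_self (y + 1)
      simp; linarith
  induction m using Fin.lastCases with
  | last =>
    rw [ChainTerm.entry_last]
    have h := hℓ s t hst (g 0).1 k (g p).1
    rw [hs, ht, hk, abs_sub_comm _ (b _)] at h
    have h1 := habs (g 0).2 (a (g 0).1)
    have h2 := habs (g p).2 (b (g p).1)
    change 4 + (((-(g 0).2 : ℤˣ) : ℤ) : ℝ) * a (g 0).1
      + (((-(g p).2 : ℤˣ) : ℤ) : ℝ) * b (g p).1 ≤ ℓ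
    rw [Units.val_neg, Units.val_neg, Int.cast_neg, Int.cast_neg]
    linarith
  | cast i =>
    rw [ChainTerm.entry_castSucc]
    obtain ⟨r, hr1, hr2⟩ := hg i i.2
    have h := hℓ r r le_rfl (g (i + 1)).1 k (g i).1
    rw [hr1, hr2, sub_self, abs_zero, abs_sub_comm _ (b _)] at h
    have h1 := habs (g (i + 1)).2 (a (g (i + 1)).1)
    have h2 := habs (g i).2 (b (g i).1)
    change 2 + (((-(g (i + 1)).2 : ℤˣ) : ℤ) : ℝ) * a (g (i + 1)).1
      + (((-(g i).2 : ℤˣ) : ℤ) : ℝ) * b (g i).1 ≤ ℓ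
    rw [Units.val_neg, Units.val_neg, Int.cast_neg, Int.cast_neg]
    linarith

theorem edist_add_edist_add_edist_le_eVariationOn {X : Type*} [PseudoEMetricSpace X]
    (γ : unitInterval → X) {s t : unitInterval} (hst : s ≤ t) :
    edist (γ 0) (γ s) + edist (γ s) (γ t) + edist (γ t) (γ 1) ≤ eVariationOn γ Set.univ := by
  have h0 : 0 ≤ s := s.2.1
  have h1 : t ≤ 1 := t.2.2
  have key : ∀ {u v : unitInterval}, u ≤ v →
      edist (γ u) (γ v) ≤ eVariationOn γ (Set.univ ∩ Set.Icc u v) := fun huv =>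
    eVariationOn.edist_le γ ⟨Set.mem_univ _, Set.left_mem_Icc.2 huv⟩
      ⟨Set.mem_univ _, Set.right_mem_Icc.2 huv⟩
  calc _ ≤ eVariationOn γ (Set.univ ∩ Set.Icc 0 s) + eVariationOn γ (Set.univ ∩ Set.Icc s t)
        + eVariationOn γ (Set.univ ∩ Set.Icc t 1) := by gcongr <;> exact key ‹_›
    _ = eVariationOn γ (Set.univ ∩ Set.Icc 0 1) := by
      rw [eVariationOn.Icc_add_Icc γ h0 hst (Set.mem_univ _),
        eVariationOn.Icc_add_Icc γ (h0.trans hst) h1 (Set.mem_univ _)]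
    _ ≤ _ := eVariationOn.mono γ Set.inter_subset_left

/-- The faces met by the curve cover the parameter interval by closed sets, so a chain of them joins
the faces of the end points. The shortest chain that joins two opposite faces, read in the order of
time, gives the term. -/
theorem exists_value_le_eVariationOn {n : ℕ} (hn : 0 < n) {A B : SupSphere n}
    (hA : (A : Fin n → ℝ) ⟨0, hn⟩ = 1) (hB : (B : Fin n → ℝ) ⟨0, hn⟩ = -1) (γ : Path A B)
    (hγ : eVariationOn γ Set.univ ≠ ⊤) :
    ∃ τ : ChainTerm n, τ.value A B ≤ (eVariationOn γ Set.univ).toReal := by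
  set ℓ := (eVariationOn γ Set.univ).toReal with hℓdef
  let x : unitInterval → Fin n → ℝ := fun t => γ t
  have hxcont : Continuous x := by fun_prop
  have hℓ : ∀ s t, s ≤ t → ∀ i j k,
      |(A : Fin n → ℝ) i - x s i| + |x s j - x t j| + |x t k - (B : Fin n → ℝ) k| ≤ ℓ := by
    intro s t hst i j k
    have h := edist_add_edist_add_edist_le_eVariationOn γ hst
    rw [γ.source, γ.target] at h
    have h' := ENNReal.toReal_mono hγ h
    rw [ENNReal.toReal_add (by finiteness) (by finiteness),
      ENNReal.toReal_add (by finiteness) (by finiteness)] at h'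
    simp only [← dist_edist] at h'
    refine le_trans ?_ h'
    gcongr
    · exact dist_le_pi_dist (A : Fin n → ℝ) (x s) i
    · exact dist_le_pi_dist (x s) (x t) j
    · exact dist_le_pi_dist (x t) (B : Fin n → ℝ) k
  let C : Fin n × ℤˣ → Set unitInterval := fun F => {t | x t F.1 = ((F.2 : ℤ) : ℝ)}
  have hC : ∀ F, IsClosed (C F) := fun F =>
    isClosed_eq ((continuous_apply F.1).comp hxcont) continuous_const
  have hcov : ∀ t, ∃ F, t ∈ C F := by
    intro t
    have hnorm : ‖x t‖ = 1 := mem_sphere_zero_iff_norm.1 (γ t).2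
    have : Nonempty (Fin n) := ⟨⟨0, hn⟩⟩
    obtain ⟨i, hi⟩ := Finite.exists_max fun i => ‖x t i‖
    have h1 : |x t i| = 1 := by
      rw [← hnorm, ← Real.norm_eq_abs]
      exact le_antisymm (norm_le_pi_norm _ i) ((pi_norm_le_iff_of_nonneg (norm_nonneg _)).2 hi)
    rcases eq_or_eq_neg_of_abs_eq h1 with h | h
    · exact ⟨(i, 1), by simp [C, h]⟩
    · exact ⟨(i, -1), by simp [C, h]⟩
  have hchain := reflTransGen_of_closed_cover hC hcov (i := (⟨0, hn⟩, 1)) (j := (⟨0, hn⟩, -1))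
    ⟨0, by simp [C, x, hA]⟩ ⟨1, by simp [C, x, hB]⟩
  obtain ⟨p, f, ⟨hf, hopp, hside⟩, hinj⟩ := exists_isOppositeChain_injOn hchain
  have hside' : ∀ i, 1 ≤ i → i ≤ p → ((f i).1 : ℕ) ≠ 0 := fun i h1 h2 h3 =>
    hside i h1 h2 (Fin.ext h3)
  obtain ⟨s, hs0, hs1⟩ := hf 0 p.zero_le
  obtain ⟨t, htp, htq⟩ := hf p le_rfl
  simp only [C, Set.mem_ofPred_eq] at hs0 hs1 htp htq
  rw [hopp] at htq
  have hst : |x s (f 0).1 - x t (f 0).1| = 2 := by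
    have h2 : x t (f 0).1 = (((-(f 0).2 : ℤˣ) : ℤ) : ℝ) := htq
    rw [hs0, h2]
    rcases Int.units_eq_one_or (f 0).2 with h | h <;> rw [h] <;> norm_num
  obtain ⟨q, rfl⟩ : ∃ q, p = q + 1 := by
    -- a face and its opposite are never met simultaneously
    refine Nat.exists_eq_succ_of_ne_zero fun hp => ?_
    subst hp
    have h2 : x t (f 0).1 = (((-(f 0).2 : ℤˣ) : ℤ) : ℝ) := htq
    rw [htp] at h2
    rcases Int.units_eq_one_or (f 0).2 with h | h <;> rw [h] at h2 <;> norm_num at h2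
  rcases le_total s t with h | h
  · refine exists_value_le_of_chain hℓ (p := q) (g := fun i => f (i + 1))
      (fun i hi => hside' _ (by omega) (by omega))
      (fun i j hij hj => hinj _ _ (by omega) (by omega) (by omega))
      (fun i hi => hf (i + 1) (by omega)) h hs1 htp hst
  · refine exists_value_le_of_chain hℓ (p := q) (g := fun i => f (q - i + 1))
      (fun i hi => hside' _ (by omega) (by omega))
      (fun i j hij hj => (hinj _ _ (by omega) (by omega) (by omega)).symm)
      (fun i hi => ?_) h htp (by simpa using hs1) (by rwa [abs_sub_comm])
    obtain ⟨r, hr1, hr2⟩ := hf (q - (i + 1) + 1) (by omega)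
    refine ⟨r, ?_, hr1⟩
    rwa [show q - (i + 1) + 1 + 1 = q - i + 1 by omega] at hr2

/-! ### The number of terms -/

theorem sum_descFactorial_mul_two_pow (N : ℕ) :
    (∑ k ∈ Finset.range (N + 1), (N.descFactorial k * 2 ^ k : ℝ)) =
      N.factorial * 2 ^ N * ∑ j ∈ Finset.range (N + 1), (1 / 2 : ℝ) ^ j / j.factorial := by
  rw [← Finset.sum_range_reflect, Finset.mul_sum]
  refine Finset.sum_congr rfl fun j hj => ?_
  have hj' : j ≤ N := Nat.lt_succ_iff.1 (Finset.mem_range.1 hj)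
  have h1 : ((j.factorial : ℕ) : ℝ) * (N.descFactorial (N - j) : ℕ) = N.factorial := by
    have := Nat.factorial_mul_descFactorial (Nat.sub_le N j)
    rw [Nat.sub_sub_self hj'] at this
    exact_mod_cast this
  have h2 : (2 : ℝ) ^ N = 2 ^ (N - j) * 2 ^ j := by rw [← pow_add, Nat.sub_add_cancel hj']
  have h3 : (j.factorial : ℝ) ≠ 0 := by positivity
  rw [show N + 1 - 1 - j = N - j by omega, ← h1, h2, div_pow, one_pow]
  field_simp

/-- The number of injective sequences over an `N`-element set weighted by `2` to the length is the
integer part of `N! 2 ^ N √e`: the tail of the exponential series of `1 / 2` after the term of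
index `N` is positive and smaller than `1 / (N! 2 ^ N)`. -/
theorem floor_factorial_mul_two_pow_mul_sqrt_exp {N : ℕ} (hN1 : 1 ≤ N) :
    ⌊(N.factorial : ℝ) * 2 ^ N * Real.sqrt (Real.exp 1)⌋ =
      ∑ k ∈ Finset.range (N + 1), (N.descFactorial k * 2 ^ k : ℤ) := by
  have hexp : Real.sqrt (Real.exp 1) = Real.exp (1 / 2) := by
    rw [Real.exp_half]
  have hpos : (0 : ℝ) < N.factorial * 2 ^ N := by positivity
  rw [hexp, Int.floor_eq_iff]
  push_cast
  rw [sum_descFactorial_mul_two_pow]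
  constructor
  · exact mul_le_mul_of_nonneg_left (Real.sum_le_exp_of_nonneg (by norm_num) _) hpos.le
  · have h := Real.exp_bound' (x := 1 / 2) (by norm_num) (by norm_num) (Nat.succ_pos N)
    refine (mul_le_mul_of_nonneg_left h hpos.le).trans_lt ?_
    rw [mul_add, add_lt_add_iff_left, Nat.succ_eq_add_one, Nat.factorial_succ]
    have hN : (1 : ℝ) ≤ N := by exact_mod_cast hN1
    have hf : (0 : ℝ) < N.factorial := by positivity
    have : (N.factorial : ℝ) * 2 ^ N * ((1 / 2) ^ (N + 1) * (((N + 1 : ℕ) : ℝ) + 1)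
        / (((N + 1) * N.factorial : ℕ) * ((N + 1 : ℕ) : ℝ))) = (N + 2) / (2 * (N + 1) ^ 2) := by
      push_cast
      rw [div_pow, one_pow, pow_succ]
      field_simp
      ring
    rw [this, div_lt_one (by positivity)]
    nlinarith

/-- A term as a length together with a pair of a sequence of coordinates and a sequence of signs. -/
def ChainTerm.equivSigma (n : ℕ) : ChainTerm n ≃
    Σ p : Fin (n - 1), (Fin (p + 1) ↪ {i : Fin n // (i : ℕ) ≠ 0}) × (Fin (p + 1) → ℤˣ) where
  toFun t := ⟨t.p, t.c, t.ε⟩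
  invFun s := ⟨s.1, s.2.1, s.2.2⟩
  left_inv _ := rfl
  right_inv _ := rfl

instance (n : ℕ) : Finite (ChainTerm n) := Finite.of_equiv _ (ChainTerm.equivSigma n).symm

theorem ChainTerm.card_eq_sum (n : ℕ) :
    Nat.card (ChainTerm n) =
      ∑ p ∈ Finset.range (n - 1), (n - 1).descFactorial (p + 1) * 2 ^ (p + 1) := by
  have hside : Fintype.card {i : Fin n // (i : ℕ) ≠ 0} = n - 1 := by
    cases n with
    | zero => rfl
    | succ N =>
      rw [Fintype.card_subtype, show (Finset.univ.filter fun i : Fin (N + 1) => (i : ℕ) ≠ 0)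
        = {0}ᶜ by ext i; simp [← Fin.val_eq_zero_iff], Finset.card_compl]
      simp
  rw [Nat.card_congr (ChainTerm.equivSigma n), Nat.card_eq_fintype_card, Fintype.card_sigma,
    Finset.sum_range]
  refine Finset.sum_congr rfl fun p _ => ?_
  rw [Fintype.card_prod, Fintype.card_embedding_eq, hside]
  simp

theorem ChainTerm.card_eq_floor {n : ℕ} (hn : 2 ≤ n) :
    (Nat.card (ChainTerm n) : ℤ) =
      ⌊((n - 1).factorial : ℝ) * 2 ^ (n - 1) * Real.sqrt (Real.exp 1)⌋ - 1 := by
  rw [floor_factorial_mul_two_pow_mul_sqrt_exp (by omega), ChainTerm.card_eq_sum, Finset.sum_range_succ']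
  push_cast
  simp

/-! ### The distance and the number of terms -/

theorem theorem4 (n : ℕ) (hn : 3 ≤ n) :
    (∀ A B : SupSphere n,
      (A : Fin n → ℝ) ⟨0, by omega⟩ = 1 → (B : Fin n → ℝ) ⟨0, by omega⟩ = -1 →
        geodEDist A B ≠ ⊤ ∧
        IsLeast (Set.range fun t : ChainTerm n => t.value A B) (geodEDist A B).toReal) ∧
    (Finite (ChainTerm n) ∧
      (Nat.card (ChainTerm n) : ℤ) =
        ⌊((n - 1).factorial : ℝ) * 2 ^ (n - 1) * Real.sqrt (Real.exp 1)⌋ - 1) := by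
  refine ⟨fun A B hA hB => ?_, inferInstance, ChainTerm.card_eq_floor (by omega)⟩
  have hn0 : 0 < n := by omega
  have : Nonempty (ChainTerm n) :=
    ⟨⟨⟨0, by omega⟩, ⟨fun _ => ⟨⟨1, by omega⟩, one_ne_zero⟩,
      fun i j _ => Fin.ext (by have := i.2; have := j.2; simp at *)⟩, fun _ => 1⟩⟩
  obtain ⟨t₀, ht₀⟩ := Finite.exists_min fun t : ChainTerm n => t.value A B
  have heq : geodEDist A B = ENNReal.ofReal (t₀.value A B) := by
    refine le_antisymm (geodEDist_le_value hn0 hA hB t₀) (le_iInf fun γ => ?_)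
    by_cases hγ : eVariationOn γ Set.univ = ⊤
    · simp [hγ]
    obtain ⟨t, ht⟩ := exists_value_le_eVariationOn hn0 hA hB γ hγ
    exact ENNReal.ofReal_le_of_le_toReal ((ht₀ t).trans ht)
  rw [heq, ENNReal.toReal_ofReal (t₀.value_nonneg A B)]
  exact ⟨ENNReal.ofReal_ne_top, ⟨t₀, rfl⟩, by rintro _ ⟨t, rfl⟩; exact ht₀ t⟩
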